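/- All graphs are finite and simple. A CFON coloring of a graph $G$ is an assignment of a color to every vertex of $G$ such that for every vertex $v$ the open neighborhood $N_G(v)$ contains a vertex whose color differs from the color of every other vertex of $N_G(v)$; if $G$ has no isolated vertex, $\chi_{ON}(G)$ denotes the smallest number of colors in a CFON coloring of $G$. The line graph of a graph $H$ has the edges of $H$ as its vertices, two distinct edges being adjacent if they share an endpoint. (a) For every real $\varepsilon>0$ there is a constant $C>0$, depending only on $\varepsilon$, such that every graph $G$ without isolated vertices that is (isomorphic to) the line graph of some graph, and whose maximum degree $\Delta$ is at least $2$, satisfies $\chi_{ON}(G)\le C(\log\Delta)^{2+\varepsilon}$. (b) There is an absolute constant $c>0$ such that for every integer $\Delta\ge 1$ there is a line graph $G$ without isolated vertices, of maximum degree exactly $\Delta$, with $\chi_{ON}(G)\ge c\log\Delta$. -/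

import Mathlib

universe u

/-- An assignment `c` of colors to the vertices of the hypergraph `H` is conflict-free if every
edge `e` of `H` contains a vertex whose color differs from that of every other vertex of `e`. -/
def Hypergraph.IsConflictFree {α κ : Type*} (H : Hypergraph α) (c : H.vertexSet → κ) : Prop :=
  ∀ e ∈ H.edgeSet, ∃ x : H.vertexSet, (x : α) ∈ e ∧
    ∀ y : H.vertexSet, (y : α) ∈ e → y ≠ x → c y ≠ c x

/-- The conflict-free chromatic number: the smallest number of colors of a conflict-free coloring,
with value `⊤` if there is no conflict-free coloring with finitely many colors. -/
noncomputable def Hypergraph.cfChromaticNumber {α : Type*} (H : Hypergraph α) : ℕ∞ :=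
  ⨅ n ∈ {n : ℕ | ∃ c : H.vertexSet → Fin n, H.IsConflictFree c}, (n : ℕ∞)

/-- The hypergraph on the vertices of `G` whose edges are the open neighborhoods in `G`. -/
def SimpleGraph.neighborHypergraph {V : Type*} (G : SimpleGraph V) : Hypergraph V where
  vertexSet := Set.univ
  edgeSet := Set.range G.neighborSet
  subset_vertexSet_of_mem_edgeSet' := fun _ _ => Set.subset_univ _

/-- The CFON chromatic number (conflict-free coloring on open neighborhoods) of a graph. -/
noncomputable def SimpleGraph.cfonChromaticNumber {V : Type*} (G : SimpleGraph V) : ℕ∞ :=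
  G.neighborHypergraph.cfChromaticNumber

/-- `G` is (isomorphic to) the line graph of some finite simple graph. -/
def SimpleGraph.IsLineGraph {W : Type u} (G : SimpleGraph W) : Prop :=
  ∃ (V : Type u) (_ : Finite V) (H : SimpleGraph V), Nonempty (G ≃g H.lineGraph)

/-! Upper bound. Let `G` be the line graph of `H`. The degrees in `H` are at most `Δ + 1`, so `H`
has a proper coloring by binary words of length `ℓ = O(log Δ)`. Assigning each edge to a position
where the words of its ends differ splits `H` into `ℓ` bipartite graphs with disjoint palettes. In
each of them a minimal dominating set of one side gives a star forest, and five colors serve every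
edge except those that form a star alone (`exists_starForest_coloring`,
`exists_edge_coloring_seesUnique`). The exceptional set `M` is a union of independent color classes
of the line graph. Since line graphs are claw-free, `O(ℓ)` refining colors serve `M` as well
(`IsClawFree.exists_refinement`). This makes `O(ℓ ^ 2)` colors, so exponent 2 already suffices.

Lower bound. Record for each vertex of a clique of `H`, and each color, whether 0, 1 or at least 2
incident edges have that color. The edge joining two vertices sees a unique color, at which their
records differ. So a clique has at most `3 ^ k` vertices. -/

namespace SimpleGraph

/-- The vertex `v` has a neighbor whose color differs from that of every other neighbor of `v`. -/
def SeesUnique {E κ : Type*} (L : SimpleGraph E) (c : E → κ) (v : E) : Prop :=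
  ∃ w, L.Adj v w ∧ ∀ w', L.Adj v w' → w' ≠ w → c w' ≠ c w

/-- Among any three distinct neighbors of a vertex, two are adjacent. -/
def IsClawFree {E : Type*} (L : SimpleGraph E) : Prop :=
  ∀ ⦃e x y z⦄, L.Adj e x → L.Adj e y → L.Adj e z → x ≠ y → x ≠ z → y ≠ z →
    L.Adj x y ∨ L.Adj x z ∨ L.Adj y z

/-! ### Greedy coloring and refinements in claw-free graphs -/

theorem colorable_of_ncard_neighborSet_le {V : Type*} [Finite V] (G : SimpleGraph V) (d : ℕ)
    (h : ∀ v, (G.neighborSet v).ncard ≤ d) : G.Colorable (d + 1) := by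
  classical
  have := Fintype.ofFinite V
  have key : ∀ s : Finset V, ∃ c : V → Fin (d + 1),
      ∀ u ∈ s, ∀ v ∈ s, G.Adj u v → c u ≠ c v := by
    intro s
    induction s using Finset.induction_on with
    | empty => exact ⟨fun _ => 0, by simp⟩
    | insert a s ha ih =>
      obtain ⟨c, hc⟩ := ih
      have hcard : ((G.neighborSet a).toFinset.image c).card < Fintype.card (Fin (d + 1)) := by
        refine lt_of_le_of_lt Finset.card_image_le ?_
        rw [← Set.ncard_eq_toFinset_card', Fintype.card_fin]
        exact Nat.lt_succ_of_le (h a)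
      obtain ⟨k, hk⟩ := Finset.exists_mem_notMem_of_card_lt_card
        (s := (G.neighborSet a).toFinset.image c) (t := Finset.univ) (by simpa using hcard)
      have hk' : ∀ v, G.Adj a v → c v ≠ k := by
        intro v hv hvk
        exact hk.2 (Finset.mem_image.2 ⟨v, by simpa using hv, hvk⟩)
      refine ⟨Function.update c a k, ?_⟩
      intro u hu v hv huv
      rcases eq_or_ne u a with rfl | hua
      · have hvu : v ≠ u := huv.ne'
        simpa [Function.update_of_ne hvu] using (hk' v huv).symm
      · rcases eq_or_ne v a with rfl | hva
        · simpa [Function.update_of_ne hua] using hk' u huv.symm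
        · rw [Function.update_of_ne hua, Function.update_of_ne hva]
          exact hc u (Finset.mem_of_mem_insert_of_ne hu hua) v
            (Finset.mem_of_mem_insert_of_ne hv hva) huv
  obtain ⟨c, hc⟩ := key Finset.univ
  exact ⟨Coloring.mk c fun {u v} huv => hc u (by simp) v (by simp) huv⟩

theorem IsClawFree.card_le_two {E : Type*} {L : SimpleGraph E} (hL : L.IsClawFree) (e : E)
    (s : Finset E) (hs : ∀ x ∈ s, L.Adj e x) (hi : ∀ x ∈ s, ∀ y ∈ s, ¬ L.Adj x y) :
    s.card ≤ 2 := by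
  by_contra! h
  obtain ⟨a, ha, b, hb, c, hc, hab, hac, hbc⟩ := Finset.two_lt_card.1 h
  rcases hL (hs a ha) (hs b hb) (hs c hc) hab hac hbc with h | h | h
  exacts [hi a ha b hb h, hi a ha c hc h, hi b hb c hc h]

/-- The vertices of `M` with a neighbor in `M` can be served by refining the color classes
inside `M`. -/
theorem IsClawFree.exists_refinement_of_independent {E κ : Type*} [Finite E] [Fintype κ]
    {L : SimpleGraph E} (hL : L.IsClawFree) (M : Set E) (c : E → κ)
    (hM : ∀ f ∈ M, ∀ g, c g = c f → g ∈ M ∧ ¬ L.Adj f g) :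
    ∃ x : E → Fin (4 * Fintype.card κ + 1), ∀ e ∈ M, ∀ f ∈ M, ∀ g, L.Adj e f → L.Adj e g →
      g ≠ f → (c g, x g) ≠ (c f, x f) := by
  classical
  have := Fintype.ofFinite E
  -- Conflict graph: two vertices of `M` of equal color with a common neighbor in `M` must be
  -- separated.
  let K : SimpleGraph E :=
    { Adj := fun f g => f ≠ g ∧ f ∈ M ∧ g ∈ M ∧ c g = c f ∧ ∃ e ∈ M, L.Adj e f ∧ L.Adj e g
      symm := ⟨fun f g ⟨h1, h2, h3, h4, e, h5, h6, h7⟩ =>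
        ⟨h1.symm, h3, h2, h4.symm, e, h5, h7, h6⟩⟩
      loopless := ⟨fun f h => h.1 rfl⟩ }
  have hK : K.Colorable (4 * Fintype.card κ + 1) := by
    apply colorable_of_ncard_neighborSet_le
    intro f
    by_cases hf : f ∈ M
    swap
    · have : K.neighborSet f = ∅ := by
        ext g; simp only [mem_neighborSet, Set.mem_empty_iff_false, iff_false]
        exact fun h => hf h.2.1
      simp [this]
    -- Color classes inside `M` are independent, so by claw-freeness `f` has at most 2 neighbors in
    -- `M` of each color, and each of these has at most 2 neighbors of the color of `f`: the degree
    -- in `K` is at most `4 * card κ`.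
    let N : Finset E := Finset.univ.biUnion fun k : κ =>
      Finset.univ.filter fun e => e ∈ M ∧ L.Adj f e ∧ c e = k
    have hN : N.card ≤ Fintype.card κ * 2 := by
      refine Finset.card_biUnion_le_card_mul _ _ _ fun k _ => hL.card_le_two f _ ?_ ?_
      · intro x hx; exact (Finset.mem_filter.1 hx).2.2.1
      · intro x hx y hy
        have hx := (Finset.mem_filter.1 hx).2
        have hy := (Finset.mem_filter.1 hy).2
        exact (hM x hx.1 y (hy.2.2.trans hx.2.2.symm)).2
    let S : Finset E := N.biUnion fun e => Finset.univ.filter fun g => L.Adj e g ∧ c g = c f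
    have hS : S.card ≤ N.card * 2 := by
      refine Finset.card_biUnion_le_card_mul _ _ _ fun e _ => hL.card_le_two e _ ?_ ?_
      · intro x hx; exact (Finset.mem_filter.1 hx).2.1
      · intro x hx y hy
        have hx := (Finset.mem_filter.1 hx).2
        have hy := (Finset.mem_filter.1 hy).2
        exact (hM x (hM f hf x hx.2).1 y (hy.2.trans hx.2.symm)).2
    have hsub : K.neighborSet f ⊆ (S : Set E) := by
      rintro g ⟨-, -, hg, hc, e, he, hef, heg⟩
      simp only [S, N, Finset.coe_biUnion, Set.mem_iUnion, Finset.mem_coe,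
        Finset.mem_filter, Finset.mem_univ, true_and, exists_prop]
      exact ⟨e, ⟨c e, he, hef.symm, rfl⟩, heg, hc⟩
    have := Set.ncard_le_ncard hsub S.finite_toSet
    rw [Set.ncard_coe_finset] at this
    omega
  obtain ⟨x⟩ := hK
  refine ⟨x, fun e he f hf g hef heg hgf h => ?_⟩
  rw [Prod.mk.injEq] at h
  exact x.valid (v := f) (w := g) ⟨hgf.symm, hf, (hM f hf g h.1).1, h.1, e, he, hef, heg⟩ h.2.symm

/-- An independent set each of whose vertices has a neighbor in `P` can be served by coloring `P`
with three colors. -/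
theorem IsClawFree.exists_serving {E : Type*} [Finite E]
    {L : SimpleGraph E} (hL : L.IsClawFree) (I P : Set E)
    (hI : ∀ e ∈ I, ∀ f ∈ I, ¬ L.Adj e f) (hP : ∀ e ∈ I, ∃ f ∈ P, L.Adj e f) :
    ∃ x : E → Fin 3, ∀ e ∈ I, ∃ f ∈ P, L.Adj e f ∧ ∀ g ∈ P, L.Adj e g → g ≠ f → x g ≠ x f := by
  classical
  obtain ⟨Q, -, hQ⟩ := (Set.toFinite {Q : Set E | Q ⊆ P ∧ ∀ e ∈ I, ∃ f ∈ Q, L.Adj e f}).exists_le_minimal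
    (a := P) ⟨subset_rfl, hP⟩
  have hQP : Q ⊆ P := hQ.prop.1
  have hQI : ∀ e ∈ I, ∃ f ∈ Q, L.Adj e f := hQ.prop.2
  -- By minimality each `f ∈ Q` has a private vertex in `I`, whose only neighbor in `Q` is `f`.
  have hpriv : ∀ f ∈ Q, ∃ e ∈ I, L.Adj e f ∧ ∀ g ∈ Q, L.Adj e g → g = f := by
    intro f hf
    by_contra! hcon
    have hmem : (Q \ {f}) ∈ {Q : Set E | Q ⊆ P ∧ ∀ e ∈ I, ∃ f ∈ Q, L.Adj e f} := by
      refine ⟨Set.sdiff_subset.trans hQP, fun e he => ?_⟩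
      by_cases hef : L.Adj e f
      · obtain ⟨g, hg, heg, hgf⟩ := hcon e he hef
        exact ⟨g, ⟨hg, hgf⟩, heg⟩
      · obtain ⟨g, hg, heg⟩ := hQI e he
        exact ⟨g, ⟨hg, fun h => hef (h ▸ heg)⟩, heg⟩
    have := hQ.le_of_le hmem Set.sdiff_subset hf
    exact this.2 rfl
  choose! q hq using hQI
  -- Only vertices with a second neighbor in `Q` need their chosen neighbor marked by color 1; for
  -- the others, `q e` is the only neighbor in `P` of nonzero color.
  let T : Set E := {e | e ∈ I ∧ ∃ g ∈ Q, L.Adj e g ∧ g ≠ q e}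
  let x : E → Fin 3 := fun f => if f ∈ q '' T then 1 else if f ∈ Q then 2 else 0
  refine ⟨x, fun e he => ⟨q e, hQP (hq e he).1, (hq e he).2, fun g _ heg hne => ?_⟩⟩
  have hqQ := (hq e he).1
  have hTQ : ∀ f, f ∈ q '' T → f ∈ Q := by
    rintro _ ⟨a, ha, rfl⟩
    exact (hq a ha.1).1
  by_cases hgQ : g ∈ Q
  · have heT : e ∈ T := ⟨he, g, hgQ, heg, hne⟩
    have h1 : x (q e) = 1 := if_pos ⟨e, heT, rfl⟩
    rw [h1]
    by_cases hgT : g ∈ q '' T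
    -- Otherwise `g` is the center of a claw whose leaves are `e`, `e'` and the private vertex `a`
    -- of `g`, all in `I`.
    · exfalso
      obtain ⟨e', he', rfl⟩ := hgT
      have hee : e ≠ e' := by rintro rfl; exact hne rfl
      obtain ⟨a, ha, hag, hau⟩ := hpriv _ hgQ
      have hae : a ≠ e := by
        rintro rfl
        exact hne (hau _ hqQ (hq a ha).2).symm
      have hae' : a ≠ e' := by
        rintro rfl
        obtain ⟨-, b, hb, hab, hbq⟩ := he'
        exact hbq (hau b hb hab)
      rcases hL hag.symm heg.symm (hq e' he'.1).2.symm hae hae' hee with h | h | h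
      exacts [hI _ ha _ he h, hI _ ha _ he'.1 h, hI _ he _ he'.1 h]
    · have h2 : x g = 2 := by
        simp only [x]
        rw [if_neg hgT, if_pos hgQ]
      rw [h2]
      decide
  · have hg0 : x g = 0 := by
      simp only [x]
      rw [if_neg (fun h => hgQ (hTQ g h)), if_neg hgQ]
    rw [hg0]
    simp only [x]
    split_ifs <;> decide

/-- Refining never destroys a unique color, so only `M` matters. Vertices with a neighbor in `M` are
served from inside `M`, the remaining ones from outside `M`, where all their neighbors lie. The two
palettes can overlap, and `4 * card κ + 3` is large enough for both. -/
theorem IsClawFree.exists_refinement {E κ : Type*} [Finite E] [Fintype κ]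
    {L : SimpleGraph E} (hL : L.IsClawFree) (M : Set E) (c : E → κ)
    (hM : ∀ f ∈ M, ∀ g, c g = c f → g ∈ M ∧ ¬ L.Adj f g)
    (hc : ∀ e ∉ M, L.SeesUnique c e) (hiso : ∀ e, ∃ f, L.Adj e f) :
    ∃ x : E → Fin (4 * Fintype.card κ + 3), ∀ e, L.SeesUnique (fun f => (c f, x f)) e := by
  classical
  obtain ⟨y, hy⟩ := hL.exists_refinement_of_independent M c hM
  let I : Set E := {e | e ∈ M ∧ ∀ f ∈ M, ¬ L.Adj e f}
  obtain ⟨z, hz⟩ := hL.exists_serving I Mᶜ (fun e he f hf => he.2 f hf.1) (by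
    intro e he
    obtain ⟨f, hf⟩ := hiso e
    exact ⟨f, fun h => he.2 f h hf, hf⟩)
  refine ⟨fun f => if f ∈ M then (y f).castLE (by omega) else (z f).castLE (by omega),
    fun e => ?_⟩
  by_cases he : e ∈ M
  · by_cases heI : e ∈ I
    · obtain ⟨f, hf, hef, hu⟩ := hz e heI
      refine ⟨f, hef, fun g heg hgf h => ?_⟩
      rw [Prod.mk.injEq] at h
      have hg : g ∉ M := fun h => heI.2 g h heg
      have hf' : f ∉ M := hf
      simp only [if_neg hg, if_neg hf'] at h
      exact hu g hg heg hgf (Fin.castLE_injective _ h.2)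
    · obtain ⟨f, hf, hef⟩ : ∃ f ∈ M, L.Adj e f := by
        by_contra! h
        exact heI ⟨he, h⟩
      refine ⟨f, hef, fun g heg hgf h => ?_⟩
      rw [Prod.mk.injEq] at h
      have hg : g ∈ M := (hM f hf g h.1).1
      simp only [if_pos hg, if_pos hf] at h
      exact hy e he f hf g hef heg hgf (Prod.ext h.1 (Fin.castLE_injective _ h.2))
  · obtain ⟨f, hef, hu⟩ := hc e he
    refine ⟨f, hef, fun g heg hgf h => hu g heg hgf ?_⟩
    rw [Prod.mk.injEq] at h
    exact h.1

end SimpleGraph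

/-! ### Star forests in bipartite relations -/

/-- Every finite bipartite relation has a spanning star forest `p`, together with a coloring `t` of
its edges by four colors, the color `3` being used for the stars with one edge, such that every
pair related by `R` but not in the forest sees some color exactly once, and so does every edge of
the forest in a star with at least two edges. -/
theorem exists_starForest_coloring {V : Type*} [Finite V] (R : V → V → Prop) :
    ∃ (p : V → V) (t : V → Fin 4),
      (∀ b a, R b a → R b (p b)) ∧
      (∀ b a, R b a → p b ≠ a → ∃ w, (w = b ∨ p w = a) ∧ R w (p w) ∧
        ∀ w', (w' = b ∨ p w' = a) → R w' (p w') → w' ≠ w → t w' ≠ t w) ∧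
      (∀ b, R b (p b) → t b ≠ 3 → ∃ w, w ≠ b ∧ p w = p b ∧ R w (p w) ∧
        ∀ w', w' ≠ b → p w' = p b → R w' (p w') → w' ≠ w → t w' ≠ t w) ∧
      (∀ b, R b (p b) → t b = 3 → ∀ w, p w = p b → R w (p w) → w = b) := by
  classical
  obtain ⟨A, hA⟩ := (Set.toFinite {A : Set V | ∀ b, (∃ a, R b a) → ∃ a ∈ A, R b a}).exists_minimal
    ⟨Set.univ, fun b ⟨a, ha⟩ => ⟨a, trivial, ha⟩⟩
  have hAR : ∀ b, (∃ a, R b a) → ∃ a ∈ A, R b a := hA.prop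
  choose! p hp using hAR
  let S : V → Set V := fun a => {w | R w (p w) ∧ p w = a}
  -- If the star at `p b` had only the leaf `b`, then `p b` could be dropped from `A`, because `b`
  -- is also dominated by `a`, which lies in `A` as its star is nonempty.
  have hmin : ∀ b a, R b a → p b ≠ a → (S a).Nonempty → (S (p b)).Nontrivial := by
    rintro b a hba hpa ⟨u, hu, rfl⟩
    have hb := hp b ⟨p u, hba⟩
    by_contra hnt
    have hsub := Set.not_nontrivial_iff.1 hnt
    have hmem : A \ {p b} ∈ {A : Set V | ∀ b, (∃ a, R b a) → ∃ a ∈ A, R b a} := by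
      intro w hw
      by_cases hwb : p w = p b
      · have : w = b := hsub ⟨(hp w hw).2, hwb⟩ ⟨hb.2, rfl⟩
        subst this
        exact ⟨p u, ⟨(hp u ⟨_, hu⟩).1, hpa.symm⟩, hba⟩
      · exact ⟨p w, ⟨(hp w hw).1, hwb⟩, (hp w hw).2⟩
    exact (hA.le_of_le hmem Set.sdiff_subset hb.1).2 rfl
  have hpair : ∀ a, (S a).Nontrivial → ∃ m : V × V, m.1 ∈ S a ∧ m.2 ∈ S a ∧ m.1 ≠ m.2 := by
    rintro a ⟨x, hx, y, hy, hxy⟩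
    exact ⟨(x, y), hx, hy, hxy⟩
  choose! m hm1 hm2 hm using hpair
  -- In a star with at least two edges, colors 0 and 1 occur exactly once each, so any single edge
  -- can be avoided by choosing one of them.
  let t : V → Fin 4 := fun b => if (S (p b)).Nontrivial then
    (if b = (m (p b)).1 then 0 else if b = (m (p b)).2 then 1 else 2) else 3
  have ht3 : ∀ b, t b = 3 ↔ ¬ (S (p b)).Nontrivial := by
    intro b
    simp only [t]
    split_ifs with h1 h2 h3 <;> simp [h1]
  have ht0 : ∀ b, t b = 0 ↔ (S (p b)).Nontrivial ∧ b = (m (p b)).1 := by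
    intro b
    simp only [t]
    split_ifs with h1 h2 h3 <;> constructor <;> intro h <;> first | exact absurd h (by decide) | tauto
  have ht1 : ∀ b, t b = 1 ↔ (S (p b)).Nontrivial ∧ b ≠ (m (p b)).1 ∧ b = (m (p b)).2 := by
    intro b
    simp only [t]
    split_ifs with h1 h2 h3 <;> constructor <;> intro h <;> first | exact absurd h (by decide) | tauto
  have e0 : ∀ a, (S a).Nontrivial → t (m a).1 = 0 := by
    intro a ha
    have := (hm1 a ha).2
    rw [ht0, this]
    exact ⟨ha, rfl⟩
  have e1 : ∀ a, (S a).Nontrivial → t (m a).2 = 1 := by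
    intro a ha
    have := (hm2 a ha).2
    rw [ht1, this]
    exact ⟨ha, (hm a ha).symm, rfl⟩
  have u0 : ∀ a w, p w = a → t w = 0 → w = (m a).1 := by
    rintro a w rfl h
    exact ((ht0 w).1 h).2
  have u1 : ∀ a w, p w = a → t w = 1 → w = (m a).2 := by
    rintro a w rfl h
    exact ((ht1 w).1 h).2.2
  refine ⟨p, t, fun b a h => (hp b ⟨a, h⟩).2, ?_, ?_, ?_⟩
  · intro b a hba hpa
    have hb := (hp b ⟨a, hba⟩).2
    by_cases hne : (S a).Nonempty
    · by_cases hnt : (S a).Nontrivial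
      · by_cases hb0 : t b = 0
        · refine ⟨(m a).2, .inr (hm2 a hnt).2, ?_, ?_⟩
          · exact (hm2 a hnt).1
          · rintro w (rfl | hw) - hwne h
            · rw [hb0, e1 a hnt] at h
              exact absurd h (by decide)
            · exact hwne (u1 a w hw (h.trans (e1 a hnt)))
        · refine ⟨(m a).1, .inr (hm1 a hnt).2, ?_, ?_⟩
          · exact (hm1 a hnt).1
          · rintro w (rfl | hw) - hwne h
            · exact hb0 (h.trans (e0 a hnt))
            · exact hwne (u0 a w hw (h.trans (e0 a hnt)))
      · have hsub := Set.not_nontrivial_iff.1 hnt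
        obtain ⟨u, hu⟩ := hne
        have hu3 : t u = 3 := by rw [ht3, hu.2]; exact hnt
        refine ⟨u, .inr hu.2, hu.1, ?_⟩
        rintro w (rfl | hw) hwR hwne h
        · exact (ht3 w).1 (h.trans hu3) (hmin w a hba hpa ⟨u, hu⟩)
        · exact hwne (hsub ⟨hwR, hw⟩ hu)
    · refine ⟨b, .inl rfl, hb, ?_⟩
      rintro w (rfl | hw) hwR hwne
      · exact absurd rfl hwne
      · exact absurd ⟨w, hwR, hw⟩ hne
  · intro b hb hb3
    have hnt : (S (p b)).Nontrivial := by
      by_contra h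
      exact hb3 ((ht3 b).2 h)
    by_cases hb0 : b = (m (p b)).1
    · refine ⟨(m (p b)).2, ?_, (hm2 _ hnt).2, (hm2 _ hnt).1, ?_⟩
      · intro h
        exact hm _ hnt (hb0.symm.trans h.symm)
      · intro w _ hw _ hwne h
        exact hwne (u1 _ w hw (h.trans (e1 _ hnt)))
    · refine ⟨(m (p b)).1, fun h => hb0 h.symm, (hm1 _ hnt).2, (hm1 _ hnt).1, ?_⟩
      intro w _ hw _ hwne h
      exact hwne (u0 _ w hw (h.trans (e0 _ hnt)))
  · intro b hb hb3 w hw hwR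
    exact Set.not_nontrivial_iff.1 ((ht3 b).1 hb3) ⟨hwR, hw⟩ ⟨hb, rfl⟩

/-! ### Coloring line graphs from above -/

namespace SimpleGraph

theorem lineGraph_adj_iff {V : Type*} {H : SimpleGraph V} {e f : H.edgeSet} :
    H.lineGraph.Adj e f ↔ e ≠ f ∧ ∃ v, v ∈ e.1 ∧ v ∈ f.1 := Iff.rfl

theorem isClawFree_lineGraph {V : Type*} (H : SimpleGraph V) : H.lineGraph.IsClawFree := by
  intro e x y z hx hy hz hxy hxz hyz
  obtain ⟨-, u, hue, hux⟩ := lineGraph_adj_iff.1 hx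
  obtain ⟨-, v, hve, hvy⟩ := lineGraph_adj_iff.1 hy
  obtain ⟨-, w, hwe, hwz⟩ := lineGraph_adj_iff.1 hz
  have key : u = v ∨ u = w ∨ v = w := by
    obtain ⟨e, he⟩ := e
    induction e using Sym2.ind with
    | _ a b =>
      simp only [Sym2.mem_iff] at hue hve hwe
      grind
  rcases key with rfl | rfl | rfl
  · exact .inl (lineGraph_adj_iff.2 ⟨hxy, u, hux, hvy⟩)
  · exact .inr (.inl (lineGraph_adj_iff.2 ⟨hxz, u, hux, hwz⟩))
  · exact .inr (.inr (lineGraph_adj_iff.2 ⟨hyz, v, hvy, hwz⟩))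

/-- A coloring of the edges of `H` serving all edges outside a set `M` in which edges of the same
color are not adjacent. -/
theorem exists_edge_coloring_seesUnique {V : Type*} [Finite V] (H : SimpleGraph V) {ℓ : ℕ}
    (φ : H.Coloring (Fin ℓ → Bool)) :
    ∃ (c : H.edgeSet → Fin ℓ × Option (Fin 4)) (M : Set H.edgeSet),
      (∀ f ∈ M, ∀ g, c g = c f → g ∈ M ∧ ¬ H.lineGraph.Adj f g) ∧
      ∀ e ∉ M, H.lineGraph.SeesUnique c e := by
  classical
  have hends : ∀ e : H.edgeSet, ∃ (j : Fin ℓ) (b a : V), e.1 = s(b, a) ∧ φ b j = true ∧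
      φ a j = false := by
    rintro ⟨e, he⟩
    induction e using Sym2.ind with
    | _ u v =>
      obtain ⟨j, hj⟩ := Function.ne_iff.1 (φ.valid he)
      cases hu : φ u j with
      | true => exact ⟨j, u, v, rfl, hu, by rw [hu] at hj; simpa using hj.symm⟩
      | false => exact ⟨j, v, u, Sym2.eq_swap, by rw [hu] at hj; simpa using hj.symm, hu⟩
  choose cls bE aE hE hb ha using hends
  let R : Fin ℓ → V → V → Prop := fun j b a =>
    ∃ e : H.edgeSet, cls e = j ∧ bE e = b ∧ aE e = a
  have hRb : ∀ j b a, R j b a → φ b j = true := by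
    rintro _ _ _ ⟨e, rfl, rfl, rfl⟩
    exact hb e
  have hRa : ∀ j b a, R j b a → φ a j = false := by
    rintro _ _ _ ⟨e, rfl, rfl, rfl⟩
    exact ha e
  have hRE : ∀ e, R (cls e) (bE e) (aE e) := fun e => ⟨e, rfl, rfl, rfl⟩
  have hext : ∀ e f, bE e = bE f → aE e = aE f → e = f := by
    intro e f h1 h2
    apply Subtype.ext
    rw [hE e, hE f, h1, h2]
  -- Within a class a vertex cannot be a `true` end of one edge and a `false` end of another, so
  -- adjacent edges meet on the same side.
  have hadj : ∀ e f, cls e = cls f →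
      (H.lineGraph.Adj e f ↔ e ≠ f ∧ (bE f = bE e ∨ aE f = aE e)) := by
    intro e f hef
    rw [lineGraph_adj_iff, hE e, hE f]
    refine and_congr_right fun _ => ⟨?_, ?_⟩
    · rintro ⟨v, hve, hvf⟩
      rw [Sym2.mem_iff] at hve hvf
      have h1 := hb e
      have h2 := ha e
      have h3 := hb f
      have h4 := ha f
      rw [← hef] at h3 h4
      rcases hve with rfl | rfl <;> rcases hvf with h | h
      · exact .inl h.symm
      · rw [← h, h1] at h4; exact absurd h4 (by decide)
      · rw [← h, h2] at h3; exact absurd h3 (by decide)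
      · exact .inr h.symm
    · rintro (h | h)
      · exact ⟨bE e, by simp, by simp [h]⟩
      · exact ⟨aE e, by simp, by simp [h]⟩
  choose p t h1 h2 h3 h4 using fun j => exists_starForest_coloring (R j)
  let c : H.edgeSet → Fin ℓ × Option (Fin 4) := fun e =>
    (cls e, if p (cls e) (bE e) = aE e then some (t (cls e) (bE e)) else none)
  have hcF : ∀ f, p (cls f) (bE f) = aE f → c f = (cls f, some (t (cls f) (bE f))) := by
    intro f hf
    simp only [c, if_pos hf]
  have hcEq : ∀ f g, p (cls f) (bE f) = aE f → c g = c f →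
      cls g = cls f ∧ p (cls f) (bE g) = aE g ∧ t (cls f) (bE g) = t (cls f) (bE f) := by
    intro f g hf h
    rw [hcF f hf, Prod.mk.injEq] at h
    obtain ⟨hj, ht⟩ := h
    change cls g = cls f at hj
    rw [hj] at ht
    split_ifs at ht with hg
    exact ⟨hj, hg, Option.some.inj ht⟩
  -- The one-edge stars: the forest edges of one class with color 3 form a matching.
  let M : Set H.edgeSet := {e | p (cls e) (bE e) = aE e ∧ t (cls e) (bE e) = 3}
  refine ⟨c, M, ?_, ?_⟩
  · rintro f ⟨hf, hf3⟩ g hgf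
    obtain ⟨hj, hg, ht⟩ := hcEq f g hf hgf
    refine ⟨⟨by rw [hj]; exact hg, by rw [hj]; exact ht.trans hf3⟩, ?_⟩
    rw [hadj f g hj.symm]
    rintro ⟨hne, hor⟩
    have hbb : bE g ≠ bE f := by
      intro h
      refine hne (hext f g h.symm ?_)
      rw [← hf, ← hg, h]
    rcases hor with h | h
    · exact hbb h
    · refine hbb (h4 (cls f) (bE f) ?_ hf3 (bE g) ?_ ?_)
      · rw [hf]; exact hRE f
      · rw [hf, hg, h]
      · rw [hg, ← hj]; exact hRE g
  · intro e he
    have hRp := h1 (cls e) _ _ (hRE e)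
    by_cases hp : p (cls e) (bE e) = aE e
    · have ht3 : t (cls e) (bE e) ≠ 3 := fun h => he ⟨hp, h⟩
      obtain ⟨w, hwb, hwp, ⟨f, hfj, hfb, hfa⟩, hu⟩ := h3 (cls e) (bE e) hRp ht3
      refine ⟨f, (hadj e f hfj.symm).2 ⟨?_, .inr ?_⟩, ?_⟩
      · rintro rfl; exact hwb hfb.symm
      · rw [hfa, hwp, hp]
      · intro g heg hgf hcg
        obtain ⟨hj, hg, ht⟩ := hcEq f g (by rw [hfj, hfb, hfa]) hcg
        rw [hfj] at hj hg ht
        rw [hfb] at ht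
        obtain ⟨hne, hor⟩ := (hadj e g hj.symm).1 heg
        have hgb : bE g ≠ bE e := by
          intro h
          refine hne (hext e g h.symm ?_)
          rw [← hp, ← hg, h]
        refine hu (bE g) hgb ?_ ?_ ?_ ht
        · rw [hg, hp]; exact hor.resolve_left hgb
        · rw [hg, ← hj]; exact hRE g
        · intro h
          refine hgf (hext g f (h.trans hfb.symm) ?_)
          rw [← hg, hfa, h]
    · obtain ⟨w, hw, ⟨f, hfj, hfb, hfa⟩, hu⟩ := h2 (cls e) _ _ (hRE e) hp
      refine ⟨f, (hadj e f hfj.symm).2 ⟨?_, ?_⟩, ?_⟩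
      · rintro rfl
        exact hp (by rw [hfb]; exact hfa.symm)
      · rw [hfb, hfa]; exact hw
      · intro g heg hgf hcg
        obtain ⟨hj, hg, ht⟩ := hcEq f g (by rw [hfj, hfb, hfa]) hcg
        rw [hfj] at hj hg ht
        rw [hfb] at ht
        obtain ⟨hne, hor⟩ := (hadj e g hj.symm).1 heg
        refine hu (bE g) ?_ ?_ ?_ ht
        · rw [hg]; exact hor
        · rw [hg, ← hj]; exact hRE g
        · intro h
          refine hgf (hext g f (h.trans hfb.symm) ?_)
          rw [← hg, hfa, h]

theorem exists_lineGraph_coloring_of_coloring {V : Type*} [Finite V] (H : SimpleGraph V) {ℓ : ℕ}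
    (φ : H.Coloring (Fin ℓ → Bool)) (hiso : ∀ e, ∃ f, H.lineGraph.Adj e f) :
    ∃ c : H.edgeSet → Fin (5 * ℓ * (20 * ℓ + 3)), ∀ e, H.lineGraph.SeesUnique c e := by
  obtain ⟨c, M, hM, hc⟩ := H.exists_edge_coloring_seesUnique φ
  obtain ⟨x, hx⟩ := H.isClawFree_lineGraph.exists_refinement M c hM hc hiso
  have hcard : Fintype.card ((Fin ℓ × Option (Fin 4)) ×
      Fin (4 * Fintype.card (Fin ℓ × Option (Fin 4)) + 3)) = 5 * ℓ * (20 * ℓ + 3) := by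
    simp only [Fintype.card_prod, Fintype.card_fin, Fintype.card_option]
    ring
  refine ⟨fun e => Fintype.equivFinOfCardEq hcard (c e, x e), fun e => ?_⟩
  obtain ⟨w, hw, hu⟩ := hx e
  exact ⟨w, hw, fun g hg hgw h => hu g hg hgw ((Fintype.equivFinOfCardEq hcard).injective h)⟩

/-- The edges at `v` are pairwise adjacent in the line graph, so any one of them has all the others
as neighbors. -/
theorem ncard_neighborSet_le_of_lineGraph {V : Type*} [Finite V] (H : SimpleGraph V) (Δ : ℕ)
    (h : ∀ e, (H.lineGraph.neighborSet e).ncard ≤ Δ) (v : V) :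
    (H.neighborSet v).ncard ≤ Δ + 1 := by
  classical
  rcases (H.neighborSet v).eq_empty_or_nonempty with h0 | ⟨u, hu⟩
  · simp [h0]
  have hu' : H.Adj v u := hu
  let e : H.edgeSet := ⟨s(v, u), hu'⟩
  have hinj : ((H.neighborSet v) \ {u}).ncard ≤ (H.lineGraph.neighborSet e).ncard := by
    refine Set.ncard_le_ncard_of_injOn
      (fun w => if hw : H.Adj v w then (⟨s(v, w), hw⟩ : H.edgeSet) else e) ?_ ?_ (Set.toFinite _)
    · rintro w ⟨hw, hwu⟩
      have hw : H.Adj v w := hw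
      simp only [dif_pos hw, mem_neighborSet, lineGraph_adj_iff]
      refine ⟨fun h => hwu ?_, v, by simp [e], by simp⟩
      exact (Sym2.congr_right.1 (congrArg Subtype.val h)).symm
    · rintro w ⟨hw, -⟩ w' ⟨hw', -⟩ hww
      have hw : H.Adj v w := hw
      have hw' : H.Adj v w' := hw'
      simp only [dif_pos hw, dif_pos hw'] at hww
      exact Sym2.congr_right.1 (congrArg Subtype.val hww)
  have := Set.ncard_sdiff_singleton_add_one hu (Set.toFinite _)
  have := h e
  omega

theorem exists_lineGraph_coloring {V : Type*} [Finite V] (H : SimpleGraph V) (Δ ℓ : ℕ)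
    (hΔ : ∀ e, (H.lineGraph.neighborSet e).ncard ≤ Δ) (hℓ : Δ + 2 ≤ 2 ^ ℓ)
    (hiso : ∀ e, ∃ f, H.lineGraph.Adj e f) :
    ∃ c : H.edgeSet → Fin (5 * ℓ * (20 * ℓ + 3)), ∀ e, H.lineGraph.SeesUnique c e := by
  obtain ⟨φ⟩ := (H.colorable_of_ncard_neighborSet_le (Δ + 1)
    (H.ncard_neighborSet_le_of_lineGraph Δ hΔ)).mono hℓ
  have hcard : Fintype.card (Fin ℓ → Bool) = 2 ^ ℓ := by simp
  exact H.exists_lineGraph_coloring_of_coloring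
    ((Embedding.completeGraph (Fintype.equivFinOfCardEq hcard).symm.toEmbedding).toHom.comp φ) hiso

end SimpleGraph

/-! ### The CFON chromatic number as an attained minimum -/

namespace SimpleGraph

theorem isConflictFree_neighborHypergraph_iff {V κ : Type*} (G : SimpleGraph V)
    (c : G.neighborHypergraph.vertexSet → κ) :
    G.neighborHypergraph.IsConflictFree c ↔
      ∀ v, G.SeesUnique (fun w => c ⟨w, Set.mem_univ w⟩) v := by
  constructor
  · intro h v
    obtain ⟨⟨w, _⟩, hw, hu⟩ := h (G.neighborSet v) ⟨v, rfl⟩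
    exact ⟨w, hw, fun w' hw' hne =>
      hu ⟨w', Set.mem_univ w'⟩ hw' fun h => hne (congrArg Subtype.val h)⟩
  · rintro h _ ⟨v, rfl⟩
    obtain ⟨w, hw, hu⟩ := h v
    exact ⟨⟨w, Set.mem_univ w⟩, hw, fun y hy hne => hu y hy fun h => hne (Subtype.ext h)⟩

theorem exists_cfonChromaticNumber_eq {V : Type*} (G : SimpleGraph V) {n : ℕ} (c : V → Fin n)
    (hc : ∀ v, G.SeesUnique c v) :
    ∃ k ≤ n, G.cfonChromaticNumber = (k : ℕ∞) ∧
      ∃ c' : V → Fin k, ∀ v, G.SeesUnique c' v := by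
  classical
  have hex : ∃ m, ∃ c' : G.neighborHypergraph.vertexSet → Fin m,
      G.neighborHypergraph.IsConflictFree c' :=
    ⟨n, fun w => c w, (G.isConflictFree_neighborHypergraph_iff _).2 hc⟩
  refine ⟨Nat.find hex, Nat.find_min' hex ?_, ?_, ?_⟩
  · exact ⟨fun w => c w, (G.isConflictFree_neighborHypergraph_iff _).2 hc⟩
  · refine le_antisymm (iInf₂_le (Nat.find hex) (Nat.find_spec hex)) (le_iInf₂ fun m hm => ?_)
    exact_mod_cast Nat.find_min' hex hm
  · obtain ⟨c', hc'⟩ := Nat.find_spec hex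
    exact ⟨_, (G.isConflictFree_neighborHypergraph_iff _).1 hc'⟩

theorem SeesUnique.comp_iso {V W κ : Type*} {G : SimpleGraph V} {L : SimpleGraph W} (i : G ≃g L)
    {c : W → κ} {v : V} (h : L.SeesUnique c (i v)) : G.SeesUnique (c ∘ i) v := by
  obtain ⟨w, hw, hu⟩ := h
  refine ⟨i.symm w, by rw [← i.map_adj_iff]; simpa using hw, fun g hg hgw => ?_⟩
  have := hu (i g) (i.map_adj_iff.2 hg) fun h => hgw (by rw [← h]; simp)
  simpa using this

theorem seesUnique_id {V : Type*} {G : SimpleGraph V} {v w : V} (h : G.Adj v w) {κ : Type*}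
    {c : V → κ} (hc : Function.Injective c) : G.SeesUnique c v :=
  ⟨w, h, fun _ _ hne h => hne (hc h)⟩

theorem ncard_neighborSet_eq_degree {V : Type*} (G : SimpleGraph V) (v : V)
    [Fintype (G.neighborSet v)] : (G.neighborSet v).ncard = G.degree v := by
  rw [Set.ncard_eq_toFinset_card', Set.toFinset_card, card_neighborSet_eq_degree]

/-! ### Lower bound from cliques -/

/-- If the line graph of `H` has a coloring with `k` colors in which every edge sees a unique color,
then the cliques of `H` have at most `3 ^ k` vertices. -/
theorem card_clique_le_of_lineGraph_seesUnique {V ι : Type*} [Finite V] [Fintype ι]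
    (H : SimpleGraph V) (f : ι → V) (hf : ∀ x y, x ≠ y → H.Adj (f x) (f y)) {k : ℕ}
    (c : H.edgeSet → Fin k) (hc : ∀ e, H.lineGraph.SeesUnique c e) :
    Fintype.card ι ≤ 3 ^ k := by
  classical
  let T : V → Fin k → Set H.edgeSet := fun v i => {e | v ∈ e.1 ∧ c e = i}
  let d : ι → Fin k → Fin 3 := fun x i => ⟨min (T (f x) i).ncard 2, by omega⟩
  -- If `w` at `u` has the unique color, only `w` and possibly `uv` itself carry it among the edges
  -- at `u` or `v`. The counts at `u` and `v` are then 1 and 0, or 2 and 1, and truncation at 2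
  -- keeps them apart.
  have hstep : ∀ (u v : V) (h : H.Adj u v) (w : H.edgeSet),
      w ≠ ⟨s(u, v), h⟩ → u ∈ w.1 →
      (∀ w', H.lineGraph.Adj ⟨s(u, v), h⟩ w' → w' ≠ w → c w' ≠ c w) →
      min (T u (c w)).ncard 2 ≠ min (T v (c w)).ncard 2 := by
    intro u v h w hwe huw hu
    set e : H.edgeSet := ⟨s(u, v), h⟩ with he
    have hvw : v ∉ w.1 := by
      intro hvw
      refine hwe (Subtype.ext ?_)
      exact (Sym2.mem_and_mem_iff h.ne).1 ⟨huw, hvw⟩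
    have hall : ∀ g, (u ∈ g.1 ∨ v ∈ g.1) → c g = c w → g = e ∨ g = w := by
      intro g hg hcg
      by_contra! hne
      refine hu g (lineGraph_adj_iff.2 ⟨hne.1.symm, ?_⟩) hne.2 hcg
      rcases hg with hg | hg
      · exact ⟨u, by simp [he], hg⟩
      · exact ⟨v, by simp [he], hg⟩
    have hTv : T v (c w) ⊆ {e} := by
      rintro g ⟨hg, hcg⟩
      rcases hall g (.inr hg) hcg with rfl | rfl
      · rfl
      · exact absurd hg hvw
    have hTu : T u (c w) = insert w (T v (c w)) := by
      ext g
      constructor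
      · rintro ⟨hg, hcg⟩
        rcases hall g (.inl hg) hcg with rfl | rfl
        · exact .inr ⟨by simp [he], hcg⟩
        · exact .inl rfl
      · rintro (rfl | hg)
        · exact ⟨huw, rfl⟩
        · have hge : g = e := hTv hg
          subst hge
          exact ⟨by simp [he], hg.2⟩
    have h1 : (T v (c w)).ncard ≤ 1 := by
      simpa using Set.ncard_le_ncard hTv
    rw [hTu, Set.ncard_insert_of_notMem (fun h => hvw h.1) (Set.toFinite _)]
    omega
  have hd : Function.Injective d := by
    intro x y hxy
    by_contra hne
    have hadj := hf x y hne
    obtain ⟨w, hw, hu⟩ := hc ⟨s(f x, f y), hadj⟩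
    obtain ⟨hwe, v, hve, hvw⟩ := lineGraph_adj_iff.1 hw
    have hxy' : min (T (f x) (c w)).ncard 2 = min (T (f y) (c w)).ncard 2 :=
      congrArg Fin.val (congrFun hxy (c w))
    rcases Sym2.mem_iff.1 hve with rfl | rfl
    · exact hstep _ _ hadj w hwe.symm hvw hu hxy'
    · have hsw : (⟨s(f x, f y), hadj⟩ : H.edgeSet) = ⟨s(f y, f x), hadj.symm⟩ :=
        Subtype.ext Sym2.eq_swap
      rw [hsw] at hwe hu
      exact hstep _ _ hadj.symm w hwe.symm hvw hu hxy'.symm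
  simpa using Fintype.card_le_of_injective d hd

theorem ncard_lineGraph_neighborSet {V : Type*} [Finite V] (H : SimpleGraph V) {u v : V}
    (h : H.Adj u v) : (H.lineGraph.neighborSet ⟨s(u, v), h⟩).ncard + 2 =
      (H.neighborSet u).ncard + (H.neighborSet v).ncard := by
  classical
  have hinc : ∀ w, (H.incidenceSet w).ncard = (H.neighborSet w).ncard := fun w =>
    Nat.card_congr (H.incidenceSetEquivNeighborSet w)
  have himg : Subtype.val '' (H.lineGraph.neighborSet ⟨s(u, v), h⟩) =
      (H.incidenceSet u \ {s(u, v)}) ∪ (H.incidenceSet v \ {s(u, v)}) := by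
    ext e
    constructor
    · rintro ⟨⟨e, he⟩, hadj, rfl⟩
      obtain ⟨hne, x, hx, hxe⟩ := lineGraph_adj_iff.1 hadj
      have hne' : e ≠ s(u, v) := fun h => hne (Subtype.ext h.symm)
      rcases Sym2.mem_iff.1 hx with rfl | rfl
      · exact .inl ⟨⟨he, hxe⟩, hne'⟩
      · exact .inr ⟨⟨he, hxe⟩, hne'⟩
    · rintro (⟨⟨he, hue⟩, hne⟩ | ⟨⟨he, hue⟩, hne⟩)
      · exact ⟨⟨e, he⟩, lineGraph_adj_iff.2
          ⟨fun h => hne (congrArg Subtype.val h).symm, u, by simp, hue⟩, rfl⟩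
      · exact ⟨⟨e, he⟩, lineGraph_adj_iff.2
          ⟨fun h => hne (congrArg Subtype.val h).symm, v, by simp, hue⟩, rfl⟩
  have hdisj : Disjoint (H.incidenceSet u \ {s(u, v)}) (H.incidenceSet v \ {s(u, v)}) := by
    rw [Set.disjoint_left]
    rintro e ⟨⟨-, hu⟩, hne⟩ ⟨⟨-, hv⟩, -⟩
    exact hne ((Sym2.mem_and_mem_iff h.ne).1 ⟨hu, hv⟩)
  have hu : s(u, v) ∈ H.incidenceSet u := ⟨h, by simp⟩
  have hv : s(u, v) ∈ H.incidenceSet v := ⟨h, by simp⟩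
  rw [← Set.ncard_image_of_injective _ Subtype.val_injective, himg,
    Set.ncard_union_eq hdisj (Set.toFinite _) (Set.toFinite _), ← hinc, ← hinc,
    ← Set.ncard_sdiff_singleton_add_one hu (Set.toFinite _),
    ← Set.ncard_sdiff_singleton_add_one hv (Set.toFinite _)]
  omega

/-- The star with center `none` and leaf set `B`. -/
def star (B : Type*) : SimpleGraph (Option B) where
  Adj x y := x ≠ y ∧ (x = none ∨ y = none)
  symm := ⟨fun _ _ h => ⟨h.1.symm, h.2.symm⟩⟩
  loopless := ⟨fun _ h => h.1 rfl⟩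

theorem ncard_neighborSet_star_none {B : Type*} :
    ((star B).neighborSet none).ncard = Nat.card B := by
  have : (star B).neighborSet none = some '' Set.univ := by
    ext x
    cases x <;> simp [star]
  rw [this, Set.ncard_image_of_injective _ (Option.some_injective B), Set.ncard_univ]

theorem ncard_neighborSet_star_some {B : Type*} (b : B) :
    ((star B).neighborSet (some b)).ncard = 1 := by
  have : (star B).neighborSet (some b) = {none} := by
    ext x
    cases x <;> simp [star]
  rw [this, Set.ncard_singleton]

/-- The disjoint union of the complete graph on `A` and the star with leaf set `B`. -/
def cliqueSumStar (A B : Type*) : SimpleGraph (A ⊕ Option B) := (⊤ : SimpleGraph A) ⊕g star B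

theorem ncard_neighborSet_cliqueSumStar_inl {A B : Type*} [Finite A] (a : A) :
    ((cliqueSumStar A B).neighborSet (.inl a)).ncard = Nat.card A - 1 := by
  rw [cliqueSumStar, neighborSet_sum_inl, Set.ncard_image_of_injective _ Sum.inl_injective,
    neighborSet_top, Set.ncard_compl, Set.ncard_singleton]

theorem ncard_neighborSet_cliqueSumStar_inr {A B : Type*} (x : Option B) :
    ((cliqueSumStar A B).neighborSet (.inr x)).ncard = ((star B).neighborSet x).ncard := by
  rw [cliqueSumStar, neighborSet_sum_inr, Set.ncard_image_of_injective _ Sum.inr_injective]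

theorem ncard_lineGraph_neighborSet_cliqueSumStar {A B : Type*} [Finite A] [Finite B]
    (e : (cliqueSumStar A B).edgeSet) :
    ((cliqueSumStar A B).lineGraph.neighborSet e).ncard + 2 = 2 * (Nat.card A - 1) ∨
      ((cliqueSumStar A B).lineGraph.neighborSet e).ncard + 2 = Nat.card B + 1 := by
  obtain ⟨e, he⟩ := e
  induction e using Sym2.ind with
  | _ x y =>
    have he' : (cliqueSumStar A B).Adj x y := he
    rw [ncard_lineGraph_neighborSet _ he']
    rcases x with a | x <;> rcases y with b | y
    · left
      rw [ncard_neighborSet_cliqueSumStar_inl, ncard_neighborSet_cliqueSumStar_inl]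
      omega
    · simp [cliqueSumStar] at he'
    · simp [cliqueSumStar] at he'
    · right
      rw [ncard_neighborSet_cliqueSumStar_inr, ncard_neighborSet_cliqueSumStar_inr]
      have h : (star B).Adj x y := by simpa [cliqueSumStar] using he'
      rcases x with _ | x <;> rcases y with _ | y
      · exact absurd rfl h.1
      · rw [ncard_neighborSet_star_none, ncard_neighborSet_star_some]
      · rw [ncard_neighborSet_star_none, ncard_neighborSet_star_some, add_comm]
      · simp [star] at h

theorem exists_ncard_lineGraph_neighborSet_cliqueSumStar {A B : Type*} [Finite A] [Finite B]
    [Nonempty B] : ∃ e : (cliqueSumStar A B).edgeSet,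
      ((cliqueSumStar A B).lineGraph.neighborSet e).ncard + 2 = Nat.card B + 1 := by
  obtain ⟨b⟩ := ‹Nonempty B›
  have h : (cliqueSumStar A B).Adj (.inr none) (.inr (some b)) := by
    simp [cliqueSumStar, star]
  refine ⟨⟨s(.inr none, .inr (some b)), h⟩, ?_⟩
  rw [ncard_lineGraph_neighborSet _ h, ncard_neighborSet_cliqueSumStar_inr,
    ncard_neighborSet_cliqueSumStar_inr, ncard_neighborSet_star_none, ncard_neighborSet_star_some]

theorem IsLineGraph.exists_cfonChromaticNumber_le {W : Type u} [Fintype W] {G : SimpleGraph W}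
    [DecidableRel G.Adj] (hG : G.IsLineGraph) (hiso : ∀ v, ∃ w, G.Adj v w) {ℓ : ℕ}
    (hℓ : G.maxDegree + 2 ≤ 2 ^ ℓ) :
    ∃ k ≤ 5 * ℓ * (20 * ℓ + 3), G.cfonChromaticNumber = (k : ℕ∞) := by
  obtain ⟨V, _, H, ⟨i⟩⟩ := hG
  have hdeg : ∀ e, (H.lineGraph.neighborSet e).ncard ≤ G.maxDegree := by
    intro e
    refine le_trans ?_ (G.degree_le_maxDegree (i.symm e))
    rw [← ncard_neighborSet_eq_degree]
    refine Set.ncard_le_ncard_of_injOn i.symm ?_ i.symm.injective.injOn (Set.toFinite _)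
    exact fun f hf => i.symm.map_adj_iff.2 hf
  have hiso' : ∀ e, ∃ f, H.lineGraph.Adj e f := by
    intro e
    obtain ⟨w, hw⟩ := hiso (i.symm e)
    exact ⟨i w, by simpa using i.map_adj_iff.2 hw⟩
  obtain ⟨c, hc⟩ := H.exists_lineGraph_coloring _ ℓ hdeg hℓ hiso'
  obtain ⟨k, hk, hk', -⟩ := G.exists_cfonChromaticNumber_eq (c ∘ i) fun v => (hc (i v)).comp_iso i
  exact ⟨k, hk, hk'⟩

/-- The clique on `n` vertices forces many colors; the star with `Δ + 1` leaves only makes the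
maximum degree exactly `Δ`. A clique edge meets `2 * (n - 2) ≤ Δ` others, and `n = 2` is excluded
since its single edge would be isolated. -/
theorem exists_isLineGraph_le_three_pow (Δ n : ℕ) (hΔ : 1 ≤ Δ) (hn : 2 * n ≤ Δ + 4) (hn2 : n ≠ 2) :
    ∃ (W : Type u) (_ : Fintype W) (G : SimpleGraph W) (_ : DecidableRel G.Adj),
      G.IsLineGraph ∧ (∀ v : W, ∃ w : W, G.Adj v w) ∧ G.maxDegree = Δ ∧
        ∃ k : ℕ, G.cfonChromaticNumber = (k : ℕ∞) ∧ n ≤ 3 ^ k := by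
  classical
  let A := ULift.{u} (Fin n)
  let B := ULift.{u} (Fin (Δ + 1))
  have hA : Nat.card A = n := by simp [A]
  have hB : Nat.card B = Δ + 1 := by simp [B]
  let H := cliqueSumStar A B
  have hiso : ∀ v : H.edgeSet, ∃ w, H.lineGraph.Adj v w := by
    intro e
    have hpos : (H.lineGraph.neighborSet e).ncard ≠ 0 := by
      rcases ncard_lineGraph_neighborSet_cliqueSumStar e with h | h
      · rw [hA] at h
        change (H.lineGraph.neighborSet e).ncard + 2 = _ at h
        omega
      · rw [hB] at h
        change (H.lineGraph.neighborSet e).ncard + 2 = _ at h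
        omega
    exact Set.nonempty_of_ncard_ne_zero hpos
  obtain ⟨k, -, hk, c, hc⟩ := H.lineGraph.exists_cfonChromaticNumber_eq
    (Fintype.equivFin H.edgeSet) fun v =>
      seesUnique_id (hiso v).choose_spec (Fintype.equivFin H.edgeSet).injective
  refine ⟨H.edgeSet, inferInstance, H.lineGraph, inferInstance,
    ⟨A ⊕ Option B, inferInstance, H, ⟨Iso.refl⟩⟩, hiso, le_antisymm ?_ ?_, k, hk, ?_⟩
  · refine maxDegree_le_of_forall_degree_le _ _ fun e => ?_
    rw [← ncard_neighborSet_eq_degree]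
    rcases ncard_lineGraph_neighborSet_cliqueSumStar e with h | h
    · rw [hA] at h
      change (H.lineGraph.neighborSet e).ncard + 2 = _ at h
      omega
    · rw [hB] at h
      change (H.lineGraph.neighborSet e).ncard + 2 = _ at h
      omega
  · obtain ⟨e, he⟩ := exists_ncard_lineGraph_neighborSet_cliqueSumStar (A := A) (B := B)
    refine le_trans ?_ (degree_le_maxDegree _ e)
    rw [← ncard_neighborSet_eq_degree]
    rw [hB] at he
    change (H.lineGraph.neighborSet e).ncard + 2 = _ at he
    omega
  · have := H.card_clique_le_of_lineGraph_seesUnique (ι := A) Sum.inl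
      (fun x y hxy => by simpa [H, cliqueSumStar] using hxy) c hc
    rwa [← Nat.card_eq_fintype_card, hA] at this

end SimpleGraph

/-! ### Logarithmic estimates -/

theorem corollary1 :
    (∀ ε : ℝ, 0 < ε → ∃ C : ℝ, 0 < C ∧
      ∀ (W : Type u) [Fintype W] (G : SimpleGraph W) [DecidableRel G.Adj],
        G.IsLineGraph → (∀ v : W, ∃ w : W, G.Adj v w) → 2 ≤ G.maxDegree →
          ∃ k : ℕ, G.cfonChromaticNumber = (k : ℕ∞) ∧
            (k : ℝ) ≤ C * Real.log (G.maxDegree : ℝ) ^ (2 + ε)) ∧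
    (∃ c : ℝ, 0 < c ∧ ∀ Δ : ℕ, 1 ≤ Δ →
      ∃ (W : Type u) (_ : Fintype W) (G : SimpleGraph W) (_ : DecidableRel G.Adj),
        G.IsLineGraph ∧ (∀ v : W, ∃ w : W, G.Adj v w) ∧ G.maxDegree = Δ ∧
          ∃ k : ℕ, G.cfonChromaticNumber = (k : ℕ∞) ∧
            c * Real.log (Δ : ℝ) ≤ (k : ℝ)) := by
  have hlog2 : 0 < Real.log 2 := Real.log_pos (by norm_num)
  constructor
  · intro ε hε
    refine ⟨1035 / Real.log 2 ^ (2 + ε), by positivity, fun W _ G _ hG hiso hΔ => ?_⟩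
    set Δ := G.maxDegree with hΔdef
    obtain ⟨k, hk, hk'⟩ := hG.exists_cfonChromaticNumber_le hiso (ℓ := Nat.log 2 Δ + 2) (by
      have := Nat.lt_pow_succ_log_self (b := 2) (by norm_num) Δ
      rw [pow_succ] at this ⊢
      rw [pow_succ]
      omega)
    refine ⟨k, hk', ?_⟩
    have hΔR : (2 : ℝ) ≤ Δ := by exact_mod_cast hΔ
    -- As `y ≥ 1`, the two factors satisfy `ℓ ≤ y + 2 ≤ 3 * y` and `20 * ℓ + 3 ≤ 20 * y + 43 ≤ 69 *
    -- y`, and `5 * 3 * 69 = 1035`.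
    set y : ℝ := Real.log Δ / Real.log 2 with hy
    have hy1 : 1 ≤ y := by
      rw [hy, one_le_div hlog2]
      exact Real.log_le_log (by norm_num) hΔR
    have hℓy : ((Nat.log 2 Δ : ℕ) : ℝ) ≤ y := Real.natLog_le_logb Δ 2
    have hkR : (k : ℝ) ≤ 5 * ((Nat.log 2 Δ : ℕ) + 2) * (20 * ((Nat.log 2 Δ : ℕ) + 2) + 3) := by
      exact_mod_cast hk
    have h1 : (k : ℝ) ≤ 1035 * y ^ (2 : ℝ) := by
      rw [Real.rpow_two]
      have hnn : (0 : ℝ) ≤ (Nat.log 2 Δ : ℕ) := Nat.cast_nonneg _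
      calc (k : ℝ) ≤ _ := hkR
        _ ≤ 5 * (3 * y) * (69 * y) := by
          gcongr
          · linarith
          · linarith
        _ = 1035 * y ^ 2 := by ring
    have h2 : y ^ (2 : ℝ) ≤ y ^ (2 + ε) := Real.rpow_le_rpow_of_exponent_le hy1 (by linarith)
    calc (k : ℝ) ≤ 1035 * y ^ (2 + ε) := by linarith
      _ = _ := by
        rw [hy, Real.div_rpow (Real.log_nonneg (by linarith)) hlog2.le]
        ring
  -- From `Δ ≤ n ^ 2` and `n ≤ 3 ^ k`: `log Δ ≤ 2 * k * log 3 ≤ 4 * k`.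
  · refine ⟨1 / 4, by norm_num, fun Δ hΔ => ?_⟩
    obtain ⟨n, hn, hn2, hn1, hnΔ⟩ : ∃ n, 2 * n ≤ Δ + 4 ∧ n ≠ 2 ∧ 1 ≤ n ∧ Δ ≤ n * n := by
      -- For `Δ = 1` the general choice `Δ / 2 + 2` would give the forbidden value 2.
      rcases hΔ.eq_or_lt with rfl | h
      · exact ⟨1, by omega⟩
      · exact ⟨Δ / 2 + 2, by omega, by omega, by omega, by nlinarith [Nat.div_add_mod Δ 2, Nat.mod_lt Δ two_pos]⟩
    obtain ⟨W, _, G, _, hG, hiso, hmax, k, hk, hnk⟩ :=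
      SimpleGraph.exists_isLineGraph_le_three_pow.{u} Δ n hΔ hn hn2
    refine ⟨W, _, G, _, hG, hiso, hmax, k, hk, ?_⟩
    have hlog3 : Real.log 3 ≤ 2 := by
      have := Real.log_le_sub_one_of_pos (show (0 : ℝ) < 3 by norm_num)
      linarith
    have hn0 : (0 : ℝ) < n := by exact_mod_cast hn1
    have hlogn : Real.log n ≤ k * Real.log 3 := by
      rw [← Real.log_pow]
      exact Real.log_le_log hn0 (by exact_mod_cast hnk)
    have hlogΔ : Real.log Δ ≤ Real.log n + Real.log n := by
      rw [← Real.log_mul hn0.ne' hn0.ne']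
      exact Real.log_le_log (by exact_mod_cast hΔ) (by exact_mod_cast hnΔ)
    have : (k : ℝ) * Real.log 3 ≤ k * 2 := by gcongr
    linarith
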